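/- For $0<q<\infty$ let $\ell^q$ be the space of all real sequences $x=(x_n)_{n\in\mathbb N}$ with $\sum_n |x_n|^q<\infty$, with the metric $d_q(x,y)=\bigl(\sum_n|x_n-y_n|^q\bigr)^{1/q}$ if $q\ge 1$ and $d_q(x,y)=\sum_n|x_n-y_n|^q$ if $q<1$; its closed unit ball is $\{x\in\ell^q : d_q(x,0)\le 1\}$. In a topological space $X$ the $\mathbf{\Sigma}^0_1$ sets are the open sets, the $\mathbf{\Pi}^0_n$ sets are the complements of the $\mathbf{\Sigma}^0_n$ sets, and the $\mathbf{\Sigma}^0_{n+1}$ sets are the countable unions of $\mathbf{\Pi}^0_n$ sets. A continuous reduction of $A\subseteq Z$ to $P\subseteq X$ is a continuous map $f:Z\to X$ with $A=f^{-1}[P]$. A set $P\subseteq X$ is $\mathbf{\Pi}^0_n$-complete if it is $\mathbf{\Pi}^0_n$ in $X$ and every $\mathbf{\Pi}^0_n$ subset of every zero-dimensional Polish space (one with a basis of clopen sets) continuously reduces to $P$. **Theorem 1.** For all $a,q$ with $0\le a<q<\infty$ the intersection $\bigcap_{p>a}\ell^p$ is a $\mathbf{\Pi}^0_3$-complete subset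 of $\ell^q$. Moreover the continuous reductions can be chosen to take values in the closed unit ball of $\ell^q$: for every zero-dimensional Polish space $Z$ and every $\mathbf{\Pi}^0_3$ set $A\subseteq Z$ there is a continuous $f:Z\to\ell^q$ with $A=f^{-1}\bigl[\bigcap_{p>a}\ell^p\bigr]$ and $d_q(f(z),0)\le 1$ for all $z\in Z$. It follows that $\bigcap_{p>a}\ell^p$ is not a $\mathbf{\Sigma}^0_3$ subset of $\ell^q$, and therefore it is neither an $F_\sigma$ nor a $G_\delta$ subset of $\ell^q$. -/

import Mathlib

/-- The space `ℓ^q` (`0 < q < ∞`) of the real sequences `x` with `∑ |x n| ^ q < ∞`.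
The carrier is Mathlib's `lp`, which carries no topology for `q < 1`. -/
def EllP (q : ℝ) : Type := lp (fun _ : ℕ => ℝ) (ENNReal.ofReal q)

namespace EllP

variable {q : ℝ}

/-- `x`, viewed as an element of Mathlib's `lp`. -/
def toLp (x : EllP q) : lp (fun _ : ℕ => ℝ) (ENNReal.ofReal q) := x

/-- The sequence underlying an element of `ℓ^q`. -/
def seq (x : EllP q) : ℕ → ℝ := fun n => x.toLp n

noncomputable instance : AddCommGroup (EllP q) :=
  inferInstanceAs (AddCommGroup (lp (fun _ : ℕ => ℝ) (ENNReal.ofReal q)))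

/-- The metric of `ℓ^q`: the norm distance `(∑ |x n - y n| ^ q) ^ (1 / q)` if `1 ≤ q`, and
`∑ |x n - y n| ^ q` if `0 < q < 1`. -/
noncomputable instance : Dist (EllP q) where
  dist x y :=
    if 1 ≤ q then (∑' n, |x.seq n - y.seq n| ^ q) ^ (1 / q) else ∑' n, |x.seq n - y.seq n| ^ q

theorem dist_def (x y : EllP q) : dist x y =
    if 1 ≤ q then (∑' n, |x.seq n - y.seq n| ^ q) ^ (1 / q)
    else ∑' n, |x.seq n - y.seq n| ^ q := rfl

theorem summable_sub (hq : 0 < q) (x y : EllP q) :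
    Summable fun n => |x.seq n - y.seq n| ^ q := by
  have h := (lp.memℓp (x.toLp - y.toLp)).summable
    (by rwa [ENNReal.toReal_ofReal hq.le])
  rw [ENNReal.toReal_ofReal hq.le] at h
  exact h

theorem dist_eq_norm (hq : 1 ≤ q) (x y : EllP q) :
    dist x y = ‖x.toLp - y.toLp‖ := by
  have hq0 : 0 < q := by linarith
  rw [dist_def, if_pos hq, lp.norm_eq_tsum_rpow (by rwa [ENNReal.toReal_ofReal hq0.le]),
    ENNReal.toReal_ofReal hq0.le]
  rfl

theorem seq_injective : Function.Injective (seq : EllP q → ℕ → ℝ) :=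
  fun _ _ h => Subtype.ext h

noncomputable instance [hq : Fact (0 < q)] : MetricSpace (EllP q) where
  dist_self x := by
    have h := hq.out
    simp [dist_def, Real.zero_rpow h.ne', Real.zero_rpow (inv_pos.2 h).ne']
  dist_comm x y := by simp only [dist_def, abs_sub_comm]
  dist_triangle x y z := by
    have h := hq.out
    by_cases h1 : 1 ≤ q
    · have : Fact (1 ≤ ENNReal.ofReal q) := ⟨by simpa using h1⟩
      rw [dist_eq_norm h1, dist_eq_norm h1, dist_eq_norm h1]
      exact norm_sub_le_norm_sub_add_norm_sub x.toLp y.toLp z.toLp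
    · simp only [dist_def, if_neg h1]
      rw [← (summable_sub h x y).tsum_add (summable_sub h y z)]
      refine (summable_sub h x z).tsum_le_tsum (fun n => ?_)
        ((summable_sub h x y).add (summable_sub h y z))
      refine le_trans ?_ (Real.rpow_add_le_add_rpow (abs_nonneg _) (abs_nonneg _) h.le
        (not_le.1 h1).le)
      exact Real.rpow_le_rpow (abs_nonneg _) (abs_sub_le _ _ _) h.le
  eq_of_dist_eq_zero {x y} hxy := by
    have h := hq.out
    have hnn : ∀ n, 0 ≤ |x.seq n - y.seq n| ^ q := fun n => Real.rpow_nonneg (abs_nonneg _) _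
    have h0 : ∑' n, |x.seq n - y.seq n| ^ q = 0 := by
      rw [dist_def] at hxy
      split_ifs at hxy with h1
      · exact ((Real.rpow_eq_zero_iff_of_nonneg (tsum_nonneg hnn)).1 hxy).1
      · exact hxy
    have h2 := (hasSum_zero_iff_of_nonneg hnn).1 (h0 ▸ (summable_sub h x y).hasSum)
    refine seq_injective (funext fun n => ?_)
    have h3 := ((Real.rpow_eq_zero_iff_of_nonneg (abs_nonneg _)).1 (congrFun h2 n)).1
    exact sub_eq_zero.1 (abs_eq_zero.1 h3)

/-- The intersection `⋂_{p > a} ℓ^p`, over all real `p > a`, as a subset of `ℓ^q`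
(for `0 ≤ a < q` it is contained in `ℓ^q`). -/
def interAbove (a q : ℝ) : Set (EllP q) :=
  {x | ∀ p : ℝ, a < p → Summable fun n => |x.seq n| ^ p}

end EllP

/-- `A` is a `Σ⁰ₙ` subset of `X`, for `n ≥ 1`: `Σ⁰₁` sets are the open sets, and `Σ⁰ₙ₊₁` sets are
the countable unions of `Π⁰ₙ` sets, i.e. of complements of `Σ⁰ₙ` sets.
(There is no level `0`.) -/
def IsSigmaZero {X : Type*} [TopologicalSpace X] : ℕ → Set X → Prop
  | 0, _ => False
  | 1, A => IsOpen A
  | n + 2, A => ∃ F : ℕ → Set X, (∀ i, IsSigmaZero (n + 1) (F i)ᶜ) ∧ A = ⋃ i, F i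

/-- `A` is a `Π⁰ₙ` subset of `X`: its complement is `Σ⁰ₙ`. -/
def IsPiZero {X : Type*} [TopologicalSpace X] (n : ℕ) (A : Set X) : Prop :=
  IsSigmaZero n Aᶜ

/-- `A` is an `F_σ` subset of `X`: a countable union of closed sets. -/
def IsFSigma {X : Type*} [TopologicalSpace X] (A : Set X) : Prop :=
  ∃ F : ℕ → Set X, (∀ i, IsClosed (F i)) ∧ A = ⋃ i, F i

/-- The clopen sets form a basis of the topology. -/
def IsZeroDimensional (Z : Type*) [TopologicalSpace Z] : Prop :=
  TopologicalSpace.IsTopologicalBasis {s : Set Z | IsClopen s}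

/-- `f` is a continuous reduction of `A ⊆ Z` to `B ⊆ X`. -/
def IsContinuousReduction {Z X : Type*} [TopologicalSpace Z] [TopologicalSpace X]
    (f : Z → X) (A : Set Z) (B : Set X) : Prop :=
  Continuous f ∧ A = f ⁻¹' B

universe u v

/-- `P ⊆ X` is `Π⁰ₙ`-complete: it is `Π⁰ₙ`, and every `Π⁰ₙ` subset of every zero-dimensional
Polish space continuously reduces to it. -/
def IsPiZeroComplete {X : Type v} [TopologicalSpace X] (n : ℕ) (P : Set X) : Prop :=
  IsPiZero n P ∧
    ∀ (Z : Type u) [TopologicalSpace Z] [PolishSpace Z], IsZeroDimensional Z →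
      ∀ A : Set Z, IsPiZero n A → ∃ f : Z → X, IsContinuousReduction f A P

/-! ### The finite levels of the Borel hierarchy -/

/-! A `Π⁰₃` set in a zero-dimensional space is coded by clopen sets `V (k, i)`: a point belongs to
it iff every row `k` contains it only finitely often (`IsPiZero.exists_isClopen_finite_iff`). Give
each `t = (k, i)` a block of `L t` coordinates, equal to `ε t` on `V t` and to `0` off it. Pick
exponents `s k < r k` decreasing to `a`, with `r 0 = q`, and blocks (`exists_block`) whose `s k`-sum
is at least `1` but whose `r k`-sum is at most `δ t`, where `∑ δ ≤ 1`. An infinite row `k` ruins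
summability at `s k`. If all rows are finite, then for `p > a` only finitely many active blocks have
`r k ≥ p`, and `δ` dominates the others. At exponent `q` the domination is uniform in the point,
which gives continuity and the unit ball.

Failure of `Σ⁰₃` is pulled back from a diagonal set in Baire space. -/

theorem isSigmaZero_succ_iff {X : Type*} [TopologicalSpace X] {n : ℕ} {A : Set X} :
    IsSigmaZero (n + 2) A ↔
      ∃ F : ℕ → Set X, (∀ i, IsSigmaZero (n + 1) (F i)) ∧ A = ⋃ i, (F i)ᶜ := by
  constructor
  · rintro ⟨F, hF, rfl⟩
    exact ⟨fun i => (F i)ᶜ, hF, by simp⟩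
  · rintro ⟨F, hF, rfl⟩
    exact ⟨fun i => (F i)ᶜ, by simpa using hF, rfl⟩

theorem IsSigmaZero.preimage {X Y : Type*} [TopologicalSpace X] [TopologicalSpace Y] {f : X → Y}
    (hf : Continuous f) {n : ℕ} {A : Set Y} (hA : IsSigmaZero (n + 1) A) :
    IsSigmaZero (n + 1) (f ⁻¹' A) := by
  induction n generalizing A with
  | zero => exact IsOpen.preimage hf hA
  | succ n ih =>
    obtain ⟨F, hF, rfl⟩ := isSigmaZero_succ_iff.1 hA
    exact isSigmaZero_succ_iff.2 ⟨fun i => f ⁻¹' F i, fun i => ih (hF i), by simp⟩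

theorem IsGδ.compl_isSigmaZero_two {X : Type*} [TopologicalSpace X] {A : Set X} (hA : IsGδ A) :
    IsSigmaZero 2 Aᶜ := by
  obtain ⟨f, hf, rfl⟩ := isGδ_iff_eq_iInter_nat.1 hA
  exact isSigmaZero_succ_iff.2 ⟨f, hf, by simp⟩

theorem IsGδ.isSigmaZero_three {X : Type*} [TopologicalSpace X] {A : Set X} (hA : IsGδ A) :
    IsSigmaZero 3 A :=
  isSigmaZero_succ_iff.2 ⟨fun _ => Aᶜ, fun _ => hA.compl_isSigmaZero_two, by
    simp [Set.iUnion_const]⟩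

/-- The metric matters here: it makes closed sets `Gδ`, which lifts the union one level. -/
theorem IsFSigma.isSigmaZero_three {X : Type*} [PseudoMetricSpace X] {A : Set X}
    (hA : IsFSigma A) : IsSigmaZero 3 A := by
  obtain ⟨F, hF, rfl⟩ := hA
  exact ⟨F, fun i => (hF i).isGδ.compl_isSigmaZero_two, rfl⟩

/-! ### A `Π⁰ₙ` set that is not `Σ⁰ₙ` -/

/-- The set with code `c` in the universal `Σ⁰ₙ₊₁` set built from the sequence `B`. -/
def universalSigma (B : ℕ → Set (ℕ → ℕ)) : ℕ → (ℕ → ℕ) → Set (ℕ → ℕ)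
  | 0, c => ⋃ i, B (c i)
  | n + 1, c => ⋃ i, (universalSigma B n fun j => c (Nat.pair i j))ᶜ

theorem exists_code {B : ℕ → Set (ℕ → ℕ)}
    (hB : ∀ O : Set (ℕ → ℕ), IsOpen O → ∃ c : ℕ → ℕ, O = ⋃ i, B (c i))
    {n : ℕ} {A : Set (ℕ → ℕ)} (hA : IsSigmaZero (n + 1) A) : ∃ c, A = universalSigma B n c := by
  induction n generalizing A with
  | zero => exact hB A hA
  | succ n ih =>
    obtain ⟨F, hF, rfl⟩ := isSigmaZero_succ_iff.1 hA
    choose c hc using fun i => ih (hF i)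
    refine ⟨fun m => c m.unpair.1 m.unpair.2, ?_⟩
    simp [universalSigma, ← hc]

/-- Letting the code vary continuously with the point carries the induction, and `g = id` gives the
diagonal. -/
theorem isSigmaZero_universalSigma {B : ℕ → Set (ℕ → ℕ)} (hB : ∀ i, IsOpen (B i)) (n : ℕ)
    {g : (ℕ → ℕ) → ℕ → ℕ} (hg : Continuous g) :
    IsSigmaZero (n + 1) {z | z ∈ universalSigma B n (g z)} := by
  induction n generalizing g with
  | zero =>
    have h : {z | z ∈ universalSigma B 0 (g z)} = ⋃ i, ⋃ k, {z | g z i = k} ∩ B k := by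
      ext z
      simp [universalSigma]
    rw [h]
    refine isOpen_iUnion fun i => isOpen_iUnion fun k => IsOpen.inter ?_ (hB k)
    exact (isOpen_discrete {k}).preimage ((continuous_apply i).comp hg)
  | succ n ih =>
    refine isSigmaZero_succ_iff.2 ⟨fun i =>
      {z | z ∈ universalSigma B n fun j => g z (Nat.pair i j)}, fun i => ih (by fun_prop), ?_⟩
    ext z
    simp [universalSigma]

theorem exists_seq_forall_isOpen_eq_iUnion (X : Type*) [TopologicalSpace X]
    [SecondCountableTopology X] : ∃ B : ℕ → Set X, (∀ i, IsOpen (B i)) ∧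
      ∀ O : Set X, IsOpen O → ∃ c : ℕ → ℕ, O = ⋃ i, B (c i) := by
  have hb := TopologicalSpace.isBasis_countableBasis X
  -- The empty set is adjoined as a value for the indices of basic sets not contained in `O`.
  obtain ⟨B, hB⟩ := ((TopologicalSpace.countable_countableBasis X).insert ∅).exists_eq_range
    (Set.insert_nonempty _ _)
  have hB' : ∀ i, B i ∈ insert ∅ (TopologicalSpace.countableBasis X) := fun i =>
    hB ▸ Set.mem_range_self i
  refine ⟨B, fun i => ?_, fun O hO => ?_⟩
  · rcases hB' i with h | h
    · rw [h]; exact isOpen_empty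
    · exact hb.isOpen h
  · obtain ⟨e, he⟩ : ∅ ∈ Set.range B := hB ▸ Set.mem_insert _ _
    classical
    refine ⟨fun i => if B i ⊆ O then i else e, Set.Subset.antisymm (fun x hx => ?_) ?_⟩
    · obtain ⟨v, hv, hxv, hvO⟩ := hb.exists_subset_of_mem_open hx hO
      obtain ⟨i, rfl⟩ : v ∈ Set.range B := hB ▸ Set.mem_insert_of_mem _ hv
      exact Set.mem_iUnion.2 ⟨i, by simpa [hvO] using hxv⟩
    · refine Set.iUnion_subset fun i => ?_
      dsimp only
      split_ifs with h
      · exact h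
      · simp [he]

theorem exists_isPiZero_not_isSigmaZero (n : ℕ) :
    ∃ D : Set (ℕ → ℕ), IsPiZero (n + 1) D ∧ ¬ IsSigmaZero (n + 1) D := by
  obtain ⟨B, hB, hB'⟩ := exists_seq_forall_isOpen_eq_iUnion (ℕ → ℕ)
  refine ⟨{z | z ∈ universalSigma B n z}ᶜ, ?_, fun h => ?_⟩
  · rw [IsPiZero, compl_compl]
    exact isSigmaZero_universalSigma hB n continuous_id
  · obtain ⟨c, hc⟩ := exists_code hB' h
    have h2 : c ∈ {z | z ∈ universalSigma B n z}ᶜ ↔ c ∈ universalSigma B n c := by rw [hc]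
    simp at h2

theorem isZeroDimensional_baire : IsZeroDimensional (ℕ → ℕ) := by
  refine TopologicalSpace.isTopologicalBasis_of_isOpen_of_nhds (fun s hs => IsClopen.isOpen hs)
    fun x O hx hO => ?_
  obtain ⟨v, ⟨y, n, rfl⟩, hxv, hv⟩ :=
    (PiNat.isTopologicalBasis_cylinders fun _ : ℕ => ℕ).exists_subset_of_mem_open hx hO
  refine ⟨_, ?_, hxv, hv⟩
  have h : PiNat.cylinder y n = ⋂ i ∈ Finset.range n, (fun z : ℕ → ℕ => z i) ⁻¹' {y i} := by
    ext z
    simp [PiNat.cylinder]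
  rw [Set.mem_ofPred_eq, h]
  exact isClopen_biInter_finset fun i _ => (isClopen_discrete {y i}).preimage (continuous_apply i)

/-! ### `Π⁰₃` subsets of zero-dimensional spaces -/

theorem IsZeroDimensional.exists_disjoint_isClopen {Z : Type*} [TopologicalSpace Z]
    [SecondCountableTopology Z] (hZ : IsZeroDimensional Z) {O : Set Z} (hO : IsOpen O) :
    ∃ V : ℕ → Set Z, (∀ i, IsClopen (V i)) ∧ Pairwise (Function.onFun Disjoint V) ∧
      ⋃ i, V i = O := by
  obtain ⟨S, hS, rfl⟩ := TopologicalSpace.IsTopologicalBasis.open_eq_sUnion hZ hO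
  obtain ⟨T, hT, hTS, hTU⟩ := TopologicalSpace.isOpen_sUnion_countable S
    fun s hs => (hS hs).isOpen
  obtain ⟨B, hB⟩ := (hT.insert ∅).exists_eq_range (Set.insert_nonempty _ _)
  have hBc : ∀ i, IsClopen (B i) := by
    intro i
    have h : B i ∈ insert ∅ T := hB ▸ Set.mem_range_self i
    rcases h with h | h
    · rw [h]; exact isClopen_empty
    · exact hS (hTS h)
  refine ⟨disjointed B, fun i => ?_, disjoint_disjointed B, ?_⟩
  · exact disjointedRec (fun s j hs => hs.diff (hBc j)) (hBc i)
  · rw [iUnion_disjointed, ← hTU, ← Set.sUnion_range, ← hB]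
    simp

/-- A `Π⁰₃` set is the preimage of the set of all `0`-`1` matrices with finite rows under a
continuous map. -/
theorem IsPiZero.exists_isClopen_finite_iff {Z : Type*} [TopologicalSpace Z]
    [SecondCountableTopology Z] (hZ : IsZeroDimensional Z) {A : Set Z} (hA : IsPiZero 3 A) :
    ∃ V : ℕ × ℕ → Set Z, (∀ t, IsClopen (V t)) ∧
      ∀ z, z ∈ A ↔ ∀ k, {i | z ∈ V (k, i)}.Finite := by
  obtain ⟨F, hF, hAF⟩ := hA
  choose G hG hFG using hF
  -- For fixed `k`, `m` the pieces partition the complement of `G k 0 ∪ ⋯ ∪ G k m`. So row `k` gets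
  -- exactly one entry for each `m` before the point enters some `G k i`, and none afterwards.
  choose V hV hVd hVU using fun k m => hZ.exists_disjoint_isClopen
    (isOpen_biInter_finset (s := Finset.range (m + 1)) fun i _ => (hG k i : IsOpen (G k i)ᶜ))
  refine ⟨fun t => V t.1 t.2.unpair.1 t.2.unpair.2, fun t => hV _ _ _, fun z => ?_⟩
  have hzA : z ∈ A ↔ ∀ k, ∃ m, z ∈ G k m := by
    rw [← compl_compl A, hAF, Set.compl_iUnion, Set.mem_iInter]
    simp [hFG]
  rw [hzA]
  refine forall_congr' fun k => ⟨?_, fun h => ?_⟩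
  · rintro ⟨m, hm⟩
    refine Set.Finite.of_injOn (f := fun i => i.unpair.1) (t := Set.Iio m) (fun i hi => ?_)
      (fun i hi j hj hij => ?_) (Set.finite_Iio m)
    · have h1 : z ∈ ⋃ j, V k i.unpair.1 j := Set.mem_iUnion.2 ⟨_, hi⟩
      rw [hVU] at h1
      by_contra h2
      simp only [Set.mem_Iio, not_lt] at h2
      exact Set.mem_iInter₂.1 h1 m (Finset.mem_range.2 (by omega)) hm
    · simp only [Set.mem_ofPred_eq] at hi hj hij
      rw [← hij] at hj
      by_contra hne
      have h2 : i.unpair.2 ≠ j.unpair.2 := fun h2 => hne <| by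
        rw [← Nat.pair_unpair i, ← Nat.pair_unpair j, hij, h2]
      exact Set.disjoint_left.1 (hVd k _ h2) hi hj
  · by_contra hz
    push Not at hz
    have h1 : ∀ m, ∃ j, z ∈ V k m j := fun m => by
      rw [← Set.mem_iUnion, hVU]
      exact Set.mem_iInter₂.2 fun i _ => hz i
    choose j hj using h1
    refine Set.infinite_of_injective_forall_mem (f := fun m => Nat.pair m (j m))
      (fun m m' hm => (Nat.pair_eq_pair.1 hm).1) (fun m => ?_) h
    simpa using hj m

/-! ### The metric of `ℓ^q` -/

namespace EllP

variable {q : ℝ}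

theorem exists_dist_eq_rpow (hq : 0 < q) : ∃ s : ℝ, 0 < s ∧ ∀ x y : EllP q,
    dist x y = (∑' n, |x.seq n - y.seq n| ^ q) ^ s := by
  by_cases h1 : 1 ≤ q
  · exact ⟨1 / q, by positivity, fun x y => by rw [dist_def, if_pos h1]⟩
  · exact ⟨1, one_pos, fun x y => by rw [dist_def, if_neg h1, Real.rpow_one]⟩

theorem continuous_seq [hq : Fact (0 < q)] (n : ℕ) : Continuous fun x : EllP q => x.seq n := by
  have h0 := hq.out
  obtain ⟨s, hs, hd⟩ := exists_dist_eq_rpow h0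
  refine continuous_iff_continuousAt.2 fun y => tendsto_iff_dist_tendsto_zero.2 ?_
  have hlim : Filter.Tendsto (fun x : EllP q => (dist x y ^ s⁻¹) ^ q⁻¹) (nhds y) (nhds 0) := by
    have hc : Continuous fun x : EllP q => (dist x y ^ s⁻¹) ^ q⁻¹ :=
      ((continuous_id.dist continuous_const).rpow_const fun _ => Or.inr (by positivity)).rpow_const
        fun _ => Or.inr (by positivity)
    have h := hc.tendsto y
    rwa [dist_self, Real.zero_rpow (by positivity), Real.zero_rpow (by positivity)] at h
  refine squeeze_zero (fun _ => dist_nonneg) (fun x => ?_) hlim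
  have hnn : ∀ m, 0 ≤ |x.seq m - y.seq m| ^ q := fun m => by positivity
  rw [hd, Real.rpow_rpow_inv (tsum_nonneg hnn) hs.ne', Real.dist_eq]
  calc |x.seq n - y.seq n| = (|x.seq n - y.seq n| ^ q) ^ q⁻¹ :=
        (Real.rpow_rpow_inv (abs_nonneg _) h0.ne').symm
    _ ≤ _ := Real.rpow_le_rpow (hnn n)
        ((summable_sub h0 x y).le_tsum n fun m _ => hnn m) (by positivity)

/-- The element of `ℓ^q` with a given underlying sequence. -/
def ofSeq (hq : 0 < q) (x : ℕ → ℝ) (hx : Summable fun n => |x n| ^ q) : EllP q :=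
  (⟨x, memℓp_gen (by simpa [ENNReal.toReal_ofReal hq.le] using hx)⟩ :
    lp (fun _ : ℕ => ℝ) (ENNReal.ofReal q))

theorem seq_ofSeq (hq : 0 < q) (x : ℕ → ℝ) (hx : Summable fun n => |x n| ^ q) :
    (ofSeq hq x hx).seq = x := rfl

theorem seq_zero : (0 : EllP q).seq = 0 := rfl

/-! ### The intersection is `Π⁰₃` -/

theorem summable_rpow_of_le {x : ℕ → ℝ} {p r : ℝ} (hp : 0 < p) (hpr : p ≤ r)
    (hx : Summable fun n => |x n| ^ p) : Summable fun n => |x n| ^ r := by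
  refine Summable.of_norm_bounded_eventually hx ?_
  filter_upwards [hx.tendsto_cofinite_zero.eventually (gt_mem_nhds one_pos)] with n hn
  rw [Real.norm_of_nonneg (by positivity)]
  have h1 : |x n| < 1 := lt_of_not_ge fun h => hn.not_ge (Real.one_le_rpow h hp.le)
  rcases (abs_nonneg (x n)).eq_or_lt with h0 | h0
  · rw [← h0, Real.zero_rpow hp.ne', Real.zero_rpow (hp.trans_le hpr).ne']
  · exact Real.rpow_le_rpow_of_exponent_ge h0 h1.le hpr

/-- By monotonicity in the exponent, `a + 1 / (k + 1)` suffice; for each, a bound `M` on all partial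
sums is a closed condition. -/
theorem isPiZero_interAbove {a : ℝ} [Fact (0 < q)] (ha : 0 ≤ a) :
    IsPiZero 3 (interAbove a q) := by
  have hC : ∀ k M : ℕ, IsClosed {x : EllP q | ∀ N : ℕ,
      ∑ n ∈ Finset.range N, |x.seq n| ^ (a + 1 / ((k : ℝ) + 1)) ≤ M} := fun k M => by
    simp only [Set.ofPred_forall]
    refine isClosed_iInter fun N => isClosed_le ?_ continuous_const
    exact continuous_finsetSum _ fun n _ => (continuous_seq n).abs.rpow_const
      fun _ => Or.inr (by positivity)
  refine isSigmaZero_succ_iff.2 ⟨fun k => ⋃ M : ℕ, {x : EllP q | ∀ N : ℕ,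
      ∑ n ∈ Finset.range N, |x.seq n| ^ (a + 1 / ((k : ℝ) + 1)) ≤ M},
    fun k => ⟨_, fun M => (hC k M).isOpen_compl, rfl⟩, ?_⟩
  rw [← Set.compl_iInter]
  congr 1
  ext x
  simp only [interAbove, Set.mem_ofPred_eq, Set.mem_iInter, Set.mem_iUnion]
  constructor
  · intro h k
    have hk := h (a + 1 / ((k : ℝ) + 1)) (by simp; positivity)
    obtain ⟨M, hM⟩ := exists_nat_ge (∑' n, |x.seq n| ^ (a + 1 / ((k : ℝ) + 1)))
    exact ⟨M, fun N => (hk.sum_le_tsum _ fun n _ => by positivity).trans hM⟩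
  · intro h p hp
    obtain ⟨k, hk⟩ := exists_nat_one_div_lt (sub_pos.2 hp)
    obtain ⟨M, hM⟩ := h k
    exact summable_rpow_of_le (p := a + 1 / ((k : ℝ) + 1)) (by positivity) (by linarith)
      (summable_of_sum_range_le (fun n => by positivity) hM)

end EllP

/-! ### The reduction -/

/-- With `ε = N ^ (-1 / s)` the `s`-sum is exactly `1`, while the `r`-sum `N ^ (1 - r / s)` tends to
`0`. -/
theorem exists_block {s r δ : ℝ} (hs : 0 < s) (hsr : s < r) (hδ : 0 < δ) :
    ∃ (L : ℕ) (ε : ℝ), 0 < ε ∧ ε ≤ 1 ∧ 1 ≤ L * ε ^ s ∧ L * ε ^ r ≤ δ := by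
  have hlim : Filter.Tendsto (fun N : ℕ => (N : ℝ) ^ (-(r / s - 1))) Filter.atTop (nhds 0) :=
    (tendsto_rpow_neg_atTop (sub_pos.2 ((one_lt_div hs).2 hsr))).comp tendsto_natCast_atTop_atTop
  obtain ⟨N, hN, hN1⟩ := ((hlim.eventually (gt_mem_nhds hδ)).and
    (Filter.eventually_ge_atTop 1)).exists
  have h1 : (1 : ℝ) ≤ N := by exact_mod_cast hN1
  have h0 : (0 : ℝ) < N := by linarith
  refine ⟨N, (N : ℝ) ^ (-s⁻¹), by positivity, Real.rpow_le_one_of_one_le_of_nonpos h1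
    (by simpa using hs.le), ?_, ?_⟩
  · rw [← Real.rpow_mul h0.le, neg_mul, inv_mul_cancel₀ hs.ne', Real.rpow_neg_one,
      mul_inv_cancel₀ h0.ne']
  · have he : 1 + -s⁻¹ * r = -(r / s - 1) := by ring
    calc (N : ℝ) * ((N : ℝ) ^ (-s⁻¹)) ^ r = (N : ℝ) ^ (1 + -s⁻¹ * r) := by
          rw [Real.rpow_add h0, Real.rpow_one, ← Real.rpow_mul h0.le]
      _ ≤ δ := he ▸ hN.le

theorem hasSum_block_row (N : ℕ) (b : ℝ) :
    HasSum (fun l : ℕ => if l < N then b else 0) (N * b) := by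
  have h : HasSum _ _ := hasSum_sum_of_ne_finset_zero (L := SummationFilter.unconditional ℕ) (f := fun l : ℕ => if l < N then b else 0)
    (s := Finset.range N) fun l hl => if_neg (by simpa using hl)
  rwa [Finset.sum_congr rfl fun l hl => if_pos (Finset.mem_range.1 hl), Finset.sum_const,
    Finset.card_range, nsmul_eq_mul] at h

theorem summable_block_iff {T : Type*} {L : T → ℕ} {b : T → ℝ} (hb : ∀ t, 0 ≤ b t) :
    Summable (fun x : T × ℕ => if x.2 < L x.1 then b x.1 else 0) ↔
      Summable fun t => L t * b t := by
  rw [summable_prod_of_nonneg fun x => by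
    show (0 : ℝ) ≤ if _ then _ else _
    split_ifs
    exacts [hb _, le_rfl]]
  simp only [(hasSum_block_row _ _).tsum_eq]
  exact and_iff_right fun t => (hasSum_block_row _ _).summable

theorem tsum_block {T : Type*} {L : T → ℕ} {b : T → ℝ} (hb : ∀ t, 0 ≤ b t)
    (h : Summable fun t => L t * b t) :
    ∑' x : T × ℕ, (if x.2 < L x.1 then b x.1 else 0) = ∑' t, L t * b t := by
  rw [((summable_block_iff hb).2 h).tsum_prod]
  simp only [(hasSum_block_row _ _).tsum_eq]

/-- A `0`-`1` matrix `z ∈ V (k, i)` is coded by a sequence whose `p`-sum is finite for all `p > a`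
if and only if the matrix has finite rows. -/
theorem summable_block_rpow_iff {Z : Type*} {V : ℕ × ℕ → Set Z} {L : ℕ × ℕ → ℕ}
    {ε δ : ℕ × ℕ → ℝ} {s r : ℕ → ℝ} {a : ℝ} (hsa : ∀ k, a < s k)
    (hr : Filter.Tendsto r Filter.atTop (nhds a)) (hε : ∀ t, 0 < ε t) (hε1 : ∀ t, ε t ≤ 1)
    (hs1 : ∀ t, 1 ≤ L t * ε t ^ s t.1) (hrδ : ∀ t, L t * ε t ^ r t.1 ≤ δ t)
    (hδ : Summable δ) (z : Z) :
    (∀ p, a < p → Summable fun t => L t * (V t).indicator (fun _ => ε t ^ p) z) ↔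
      ∀ k, {i | z ∈ V (k, i)}.Finite := by
  constructor
  · intro h k
    -- Each active block of row `k` contributes at least `1` at exponent `s k`.
    have h1 := (h _ (hsa k)).tendsto_cofinite_zero.eventually (gt_mem_nhds one_pos)
    refine (Set.Finite.preimage (f := fun i => (k, i))
      (fun i _ j _ hij => (Prod.ext_iff.1 hij).2) h1).subset fun i hi => ?_
    simp only [Set.mem_ofPred_eq] at hi
    simpa [Set.indicator_of_mem hi] using hs1 (k, i)
  · intro h p hp
    obtain ⟨K, hK⟩ := Filter.eventually_atTop.1 (hr.eventually (gt_mem_nhds hp))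
    refine Summable.of_norm_bounded_eventually hδ ?_
    have hfin : (⋃ k ∈ Set.Iio K, Prod.mk k '' {i | z ∈ V (k, i)}).Finite :=
      (Set.finite_Iio K).biUnion fun k _ => (h k).image _
    filter_upwards [hfin.compl_mem_cofinite] with t ht
    have h0 : 0 ≤ δ t :=
      (mul_nonneg (Nat.cast_nonneg _) (Real.rpow_nonneg (hε t).le _)).trans (hrδ t)
    by_cases hz : z ∈ V t
    · have hKt : K ≤ t.1 := by
        by_contra hKt
        exact ht (Set.mem_biUnion (Set.mem_Iio.2 (not_le.1 hKt)) ⟨t.2, hz, rfl⟩)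
      rw [Set.indicator_of_mem hz, Real.norm_of_nonneg
        (mul_nonneg (Nat.cast_nonneg _) (Real.rpow_nonneg (hε t).le _))]
      refine le_trans (mul_le_mul_of_nonneg_left ?_ (Nat.cast_nonneg _)) (hrδ t)
      exact Real.rpow_le_rpow_of_exponent_ge (hε t) (hε1 t) (hK _ hKt).le
    · simpa [Set.indicator_of_notMem hz] using h0

open EllP in
/-- A map into `ℓ^q` with continuous coordinates and dominated differences is continuous. -/
theorem EllP.continuous_of_dominated {q : ℝ} [hq : Fact (0 < q)] {Z : Type*} [TopologicalSpace Z]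
    {f : Z → EllP q} {u : ℕ → ℝ} (hu : Summable u) (hf : ∀ n, Continuous fun z => (f z).seq n)
    (hfu : ∀ z w n, |(f z).seq n - (f w).seq n| ^ q ≤ u n) : Continuous f := by
  obtain ⟨s, hs, hd⟩ := exists_dist_eq_rpow hq.out
  refine continuous_iff_continuousAt.2 fun w => tendsto_iff_dist_tendsto_zero.2 ?_
  have hc : Continuous fun z => dist (f z) (f w) := by
    simp only [hd]
    refine (continuous_tsum (fun n => ((hf n).sub continuous_const).abs.rpow_const
      fun _ => Or.inr hq.out.le) hu fun n z => ?_).rpow_const fun _ => Or.inr hs.le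
    rw [Real.norm_of_nonneg (by positivity)]
    exact hfu z w n
  simpa using hc.tendsto w

open EllP in
theorem exists_reduction_interAbove {a q : ℝ} [hq : Fact (0 < q)] (ha : 0 ≤ a) (haq : a < q)
    {Z : Type*} [TopologicalSpace Z] [SecondCountableTopology Z] (hZ : IsZeroDimensional Z)
    {A : Set Z} (hA : IsPiZero 3 A) :
    ∃ f : Z → EllP q, IsContinuousReduction f A (interAbove a q) ∧
      ∀ z, f z ∈ Metric.closedBall (0 : EllP q) 1 := by
  have h0 := hq.out
  obtain ⟨V, hV, hVA⟩ := hA.exists_isClopen_finite_iff hZ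
  obtain ⟨δ, hδ, c, hδc, hc1⟩ := posSumOfEncodable one_pos (ℕ × ℕ)
  have hqa : 0 < q - a := sub_pos.2 haq
  -- Here `s k = a + (q - a) / (k + 2)` and `r k = a + (q - a) / (k + 1)`, so `r k ≤ q` for every
  -- `k`.
  have hsr : ∀ k : ℕ, a + (q - a) / ((k : ℝ) + 2) < a + (q - a) / ((k : ℝ) + 1) := fun k => by
    gcongr
    norm_num
  have hsa : ∀ k : ℕ, a < a + (q - a) / ((k : ℝ) + 2) := fun k =>
    lt_add_of_pos_right _ (by positivity)
  choose L ε hε hε1 hs1 hrδ using fun t : ℕ × ℕ =>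
    exists_block (ha.trans_lt (hsa t.1)) (hsr t.1) (hδ t)
  have hr : Filter.Tendsto (fun k : ℕ => a + (q - a) / ((k : ℝ) + 1)) Filter.atTop (nhds a) := by
    have h := (tendsto_one_div_add_atTop_nhds_zero_nat (𝕜 := ℝ)).const_mul (q - a)
    simpa [div_eq_mul_inv] using h.const_add a
  have hqδ : ∀ t, L t * ε t ^ q ≤ δ t := fun t => by
    refine le_trans (mul_le_mul_of_nonneg_left ?_ (Nat.cast_nonneg _)) (hrδ t)
    refine Real.rpow_le_rpow_of_exponent_ge (hε t) (hε1 t) ?_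
    have : (q - a) / ((t.1 : ℝ) + 1) ≤ q - a := div_le_self hqa.le (by simp)
    linarith
  have hεq : ∀ t, 0 ≤ ε t ^ q := fun t => Real.rpow_nonneg (hε t).le _
  let e : ℕ ≃ (ℕ × ℕ) × ℕ := (Denumerable.eqv _).symm
  let u : ℕ → ℝ := fun n => if (e n).2 < L (e n).1 then ε (e n).1 ^ q else 0
  let x : Z → ℕ → ℝ := fun z n =>
    if (e n).2 < L (e n).1 then (V (e n).1).indicator (fun _ => ε (e n).1) z else 0
  have hsumL : Summable fun t => L t * ε t ^ q := Summable.of_nonneg_of_le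
    (fun t => mul_nonneg (Nat.cast_nonneg _) (hεq t)) hqδ hδc.summable
  have hu : Summable u := (e.summable_iff
    (f := fun y : (ℕ × ℕ) × ℕ => if y.2 < L y.1 then ε y.1 ^ q else 0)).2
    ((summable_block_iff hεq).2 hsumL)
  have hu1 : ∑' n, u n ≤ 1 := by
    rw [e.tsum_eq (fun y : (ℕ × ℕ) × ℕ => if y.2 < L y.1 then ε y.1 ^ q else 0),
      tsum_block hεq hsumL]
    exact ((hsumL.tsum_le_tsum hqδ hδc.summable).trans_eq hδc.tsum_eq).trans hc1
  have hxp : ∀ z n, ∀ p : ℝ, 0 < p → |x z n| ^ p =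
      if (e n).2 < L (e n).1 then (V (e n).1).indicator (fun _ => ε (e n).1 ^ p) z else 0 := by
    intro z n p hp
    by_cases h1 : (e n).2 < L (e n).1 <;> by_cases h2 : z ∈ V (e n).1 <;>
      simp [x, h1, h2, Real.zero_rpow hp.ne', abs_of_pos (hε _)]
  have hxu : ∀ z w n, |x z n - x w n| ^ q ≤ u n := by
    intro z w n
    by_cases h1 : (e n).2 < L (e n).1 <;> by_cases h2 : z ∈ V (e n).1 <;>
      by_cases h3 : w ∈ V (e n).1 <;>
      simp [x, u, h1, h2, h3, Real.zero_rpow h0.ne', abs_of_pos (hε _), hεq]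
  have hxu0 : ∀ z n, |x z n| ^ q ≤ u n := by
    intro z n
    by_cases h1 : (e n).2 < L (e n).1 <;> by_cases h2 : z ∈ V (e n).1 <;>
      simp [x, u, h1, h2, Real.zero_rpow h0.ne', abs_of_pos (hε _), hεq]
  have hxs : ∀ z, Summable fun n => |x z n| ^ q := fun z =>
    Summable.of_nonneg_of_le (fun n => by positivity) (hxu0 z) hu
  refine ⟨fun z => ofSeq h0 (x z) (hxs z), ⟨?_, ?_⟩, fun z => ?_⟩
  · refine continuous_of_dominated hu (fun n => ?_) hxu
    show Continuous fun z => x z n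
    by_cases h1 : (e n).2 < L (e n).1
    · simp only [x, h1, if_true]
      exact continuous_const.indicator fun z hz => by simp [(hV _).frontier_eq] at hz
    · simp only [x, h1, if_false]
      exact continuous_const
  · ext z
    rw [hVA, ← summable_block_rpow_iff hsa hr hε hε1 hs1 hrδ hδc.summable z]
    refine forall₂_congr fun p hp => ?_
    have hind : ∀ t, 0 ≤ (V t).indicator (fun _ => ε t ^ p) z := fun t =>
      Set.indicator_nonneg (fun _ _ => Real.rpow_nonneg (hε t).le _) z
    rw [← summable_block_iff hind, ← e.summable_iff]
    simp only [seq_ofSeq, hxp z _ p (ha.trans_lt hp)]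
    rfl
  · obtain ⟨s, hs, hd⟩ := exists_dist_eq_rpow h0
    rw [Metric.mem_closedBall, hd]
    simp only [seq_ofSeq, seq_zero, Pi.zero_apply, sub_zero]
    -- A `q`-sum at most `1` stays so under the power `s`, whichever form the metric takes.
    exact Real.rpow_le_one (tsum_nonneg fun n => by positivity)
      (((hxs z).tsum_le_tsum (hxu0 z) hu).trans hu1) hs.le

theorem theorem1 (a q : ℝ) [Fact (0 < q)] (ha : 0 ≤ a) (haq : a < q) :
    IsPiZeroComplete.{u} 3 (EllP.interAbove a q) ∧
    (∀ (Z : Type u) [TopologicalSpace Z] [PolishSpace Z], IsZeroDimensional Z →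
      ∀ A : Set Z, IsPiZero 3 A →
        ∃ f : Z → EllP q, IsContinuousReduction f A (EllP.interAbove a q) ∧
          ∀ z, f z ∈ Metric.closedBall (0 : EllP q) 1) ∧
    ¬ IsSigmaZero 3 (EllP.interAbove a q) ∧
    ¬ IsFSigma (EllP.interAbove a q) ∧
    ¬ IsGδ (EllP.interAbove a q) := by
  -- The reduction lemma is used instead of completeness, since Baire space lives in universe `0`,
  -- not `u`.
  have hnot : ¬ IsSigmaZero 3 (EllP.interAbove a q) := fun h => by
    obtain ⟨D, hD, hD'⟩ := exists_isPiZero_not_isSigmaZero 2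
    obtain ⟨f, ⟨hf, rfl⟩, -⟩ := exists_reduction_interAbove ha haq isZeroDimensional_baire hD
    exact hD' (h.preimage hf)
  refine ⟨⟨EllP.isPiZero_interAbove ha, fun Z _ _ hZ A hA => ?_⟩,
    fun Z _ _ hZ A hA => exists_reduction_interAbove ha haq hZ hA, hnot,
    fun h => hnot h.isSigmaZero_three, fun h => hnot h.isSigmaZero_three⟩
  obtain ⟨f, hf, -⟩ := exists_reduction_interAbove ha haq hZ hA
  exact ⟨f, hf⟩
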